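/- **Model.** A three-dimensional bit-meters circuit with $n$ inputs and $k$ outputs has computational nodes at the points of $\mathbb{Z}^3$. The $n$ inputs are injected into $n$ distinct input nodes, one per node; each of the $k$ outputs is produced at an output node (a node may be both an input and an output node). The computation is a finite sequence of one-bit transmissions between nodes, the pattern of which (the directed communication multigraph, with one edge per transmitted bit) is fixed independently of the inputs; each transmitted bit is an arbitrary function of the input injected into the sending node (if any) and of the bits this node has received so far, and each output is an arbitrary function of the input injected into its output node (if any) and of all bits received there. The bit-meters $\beta$ of the circuit is the sum, over all edges of the multigraph, of the Euclidean distance between the two end nodes. An $(n,k)$ bit-meters decoder is such a circuit together with an encoding function $g:\{0,1\}^k\to\{0,1\}^n$. Its block error probability $P_{\mathrm e}$ on the binary erasure channel with erasure probability $\epsilon$ is the probability that the circuit's output differs from $m$, when $m$ is uniform on $\{0,1\}^k$ and the circuit's input in $\{0,1,\mathrm{e}\}^n$ is $g(m)$ with each position replaced by the erasure symbol $\mathrm{e}$ independently with probability $\epsilon$. **Theorem.** Let $0<\epsilon<1$. There are an integer $k_0$ and a real number $p_0>0$, depending only on $\epsilon$, such that every $(n,k)$ three-dimensional bit-meters decoder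 with $k\ge 1$ for the binary erasure channel with erasure probability $\epsilon$ which satisfies $k\ge k_0$ or $P_{\mathrm e}\le p_0$ has bit-meters $$\beta>\frac{27}{512}\left(\frac{\ln(4P_{\mathrm e})}{2\ln\epsilon}\right)^{1/3}k ,$$ where $(\cdot)^{1/3}$ is the real cube root (negative for negative arguments). In particular, in every sequence of decoders of increasing block length $n$ in which $k(n)\to\infty$ (for instance, in which the rate $k(n)/n$ is bounded away from $0$), or in which $k(n)\ge 1$ and $P_{\mathrm e}(n)\to 0$, the bound holds for all sufficiently large block lengths. -/

import Mathlib

namespace BitMeters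

/-- Locations of the computational nodes: the integer lattice `ℤ³`. -/
abbrev Node : Type := Fin 3 → ℤ

/-- The point of Euclidean three-space at which a node sits. -/
noncomputable def Node.pos (v : Node) : EuclideanSpace ℝ (Fin 3) :=
  WithLp.toLp 2 (fun i => (v i : ℝ))

/-- A symbol at the output of a binary erasure channel; `none` is the erasure symbol. -/
abbrev Symbol : Type := Option Bool

/-- One edge of the communication multigraph: a single bit sent from `src` to `dst`.
The bit may be any function of what the source knows at that moment: the channel symbol injected
into it (`none` if it is not an input node) and all the bits it has received so far, in
chronological order. -/
structure Transmission where
  src : Node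
  dst : Node
  msg : Option Symbol → List Bool → Bool

/-- The cost of an edge: the Euclidean distance between its end points. -/
noncomputable def Transmission.cost (e : Transmission) : ℝ :=
  dist e.src.pos e.dst.pos

/-- A three-dimensional bit-meters circuit with `n` inputs and `k` outputs. Every input node
receives one input, and a node may be an input and an output node at once. The communication
multigraph is the list `edges`, in chronological order; it is fixed in advance (it does not depend
on the inputs), and it may contain any number of edges between two given nodes. Output `j` is a
function of all that the node `outputNode j` knows at the end of the computation. -/
structure Circuit (n k : ℕ) where
  inputNode : Fin n → Node
  inputNode_injective : Function.Injective inputNode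
  outputNode : Fin k → Node
  edges : List Transmission
  out : Fin k → Option Symbol → List Bool → Bool

namespace Circuit

variable {n k : ℕ}

/-- The channel symbol injected into a node, `none` if the node is not an input node. -/
noncomputable def inputAt (c : Circuit n k) (y : Fin n → Symbol) : Node → Option Symbol :=
  Function.extend c.inputNode (fun i => some (y i)) (fun _ => none)

/-- The effect of one transmission on the lists of bits received so far at the nodes. -/
noncomputable def step (c : Circuit n k) (y : Fin n → Symbol) (r : Node → List Bool)
    (e : Transmission) : Node → List Bool :=
  Function.update r e.dst (r e.dst ++ [e.msg (c.inputAt y e.src) (r e.src)])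

/-- The bits received at each node in the whole computation on the input `y`. -/
noncomputable def received (c : Circuit n k) (y : Fin n → Symbol) : Node → List Bool :=
  c.edges.foldl (c.step y) (fun _ => [])

/-- The function that the circuit computes. -/
noncomputable def eval (c : Circuit n k) (y : Fin n → Symbol) : Fin k → Bool :=
  fun j => c.out j (c.inputAt y (c.outputNode j)) (c.received y (c.outputNode j))

/-- The energy (bit-meters) `β`: the sum of the costs of all edges of the multigraph. -/
noncomputable def bitMeters (c : Circuit n k) : ℝ :=
  (c.edges.map Transmission.cost).sum

end Circuit

/-- The output of the erasure channel on the input word `x` when exactly the positions in `E` are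
erased. -/
def erase {n : ℕ} (x : Fin n → Bool) (E : Finset (Fin n)) : Fin n → Symbol :=
  fun i => if i ∈ E then none else some (x i)

/-- The probability that exactly the positions in `E` are erased in `n` independent uses of the
binary erasure channel with erasure probability `ε`. -/
def erasureProb {n : ℕ} (ε : ℝ) (E : Finset (Fin n)) : ℝ :=
  ε ^ E.card * (1 - ε) ^ Eᶜ.card

/-- A three-dimensional bit-meters `(n, k)`-decoder: a circuit together with the encoding function
of the code it decodes. -/
structure Decoder (n k : ℕ) where
  circuit : Circuit n k
  encode : (Fin k → Bool) → (Fin n → Bool)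

open Classical in
/-- The block error probability: the `k` source bits `m` are independent and fair, the code word
`encode m` is sent over the binary erasure channel, and an error occurs if the decoder's estimate
differs from `m`. -/
noncomputable def Decoder.blockError {n k : ℕ} (D : Decoder n k) (ε : ℝ) : ℝ :=
  ∑ m : Fin k → Bool, (1 / 2 : ℝ) ^ k *
    ∑ E : Finset (Fin n), erasureProb ε E *
      (if D.circuit.eval (erase (D.encode m) E) = m then 0 else 1)

/-- The real cube root, also of negative numbers. -/
noncomputable def cubeRoot (x : ℝ) : ℝ :=
  (SignType.sign x : ℝ) * |x| ^ (1 / 3 : ℝ)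

theorem cubeRoot_pow_three (x : ℝ) : cubeRoot x ^ 3 = x := by
  have h : (|x| ^ (1 / 3 : ℝ)) ^ 3 = |x| := by
    rw [← Real.rpow_natCast, ← Real.rpow_mul (abs_nonneg x)]
    norm_num
  rw [cubeRoot, mul_pow, h]
  rcases lt_trichotomy x 0 with hx | hx | hx
  · simp [sign_neg hx, abs_of_neg hx]
    norm_num
  · simp [hx]
  · simp [sign_pos hx, abs_of_pos hx]

end BitMeters

namespace BitMeters

/-!
If all inputs in a set `S` of nodes are erased, the outputs produced in `S` are a function of the
bits that enter `S`; when these are fewer than the outputs in `S`, at least half of the messages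
are decoded wrongly. Hence, if `S` holds at most `s³` inputs and `2 Pₑ < ε ^ s³`, at least as many
bits enter `S` as outputs are produced in it. Sum this over all translates of a cube of side `s`:
each output lies in `s³` of them, while a bit sent from `p` to `q` enters at most
`s² ‖p - q‖₁ ≤ 3 s² ‖p - q‖` of them, so that `s k ≤ 3 β`. If `Pₑ` is small, the theorem follows
with `s` the integer part of the cube root in the bound. If `Pₑ ≤ 1/4` is not small, that cube root
is less than `1`, and it is enough to apply the same sum to cubes of side `1`: except at a number
of input nodes bounded in terms of `ε`, every node receives as many bits as it outputs, since
otherwise one of these inputs is erased with probability above `1/2`, and so `k ≤ 3 β + O(1)`.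
-/

open Finset

section Cubes

variable {ι : Type*} [Fintype ι] [DecidableEq ι]

theorem card_piFinset_sdiff_piFinset_le {α : ι → Type*} [∀ i, DecidableEq (α i)]
    (A B : ∀ i, Finset (α i)) :
    #(Fintype.piFinset A \ Fintype.piFinset B) ≤
      ∑ i, #(A i \ B i) * ∏ j ∈ univ \ {i}, #(A j) := by
  have hcover : Fintype.piFinset A \ Fintype.piFinset B ⊆
      univ.biUnion fun i => Fintype.piFinset (Function.update A i (A i \ B i)) := by
    intro v hv
    obtain ⟨hvA, hvB⟩ := mem_sdiff.1 hv
    obtain ⟨i, hi⟩ := not_forall.1 (mt Fintype.mem_piFinset.2 hvB)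
    rw [Fintype.mem_piFinset] at hvA
    rw [mem_biUnion]
    refine ⟨i, mem_univ i, ?_⟩
    rw [Fintype.piFinset_update_eq_filter_piFinset_mem _ _ sdiff_subset]
    simp [hvA, hi]
  refine (card_le_card hcover).trans (card_biUnion_le.trans_eq (sum_congr rfl fun i _ => ?_))
  rw [Fintype.card_piFinset, ← prod_update_of_mem (mem_univ i) (fun j => #(A j))]
  exact prod_congr rfl fun j _ => Function.apply_update (fun _ => card) A i _ j

theorem card_Ioc_sdiff_Ioc_le (a b w : ℤ) :
    #(Ioc (a - w) a \ Ioc (b - w) b) ≤ (a - b).natAbs := by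
  have hcover : Ioc (a - w) a \ Ioc (b - w) b ⊆ Ioc (a - w) (b - w) ∪ Ioc b a := by
    intro x
    simp only [mem_sdiff, mem_union, mem_Ioc]
    omega
  refine (card_le_card hcover).trans ((card_union_le _ _).trans ?_)
  rw [Int.card_Ioc, Int.card_Ioc]
  omega

/-- The cube of side `s` in the lattice `ℤ^ι` with least corner `v`. -/
noncomputable def cube (s : ℕ) (v : ι → ℤ) : Finset (ι → ℤ) :=
  Fintype.piFinset fun i => Ico (v i) (v i + s)

/-- The least corners of the cubes of side `s` that contain the lattice point `p`. -/
noncomputable def corners (s : ℕ) (p : ι → ℤ) : Finset (ι → ℤ) :=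
  Fintype.piFinset fun i => Ioc (p i - s) (p i)

theorem mem_cube_iff_mem_corners {s : ℕ} {v p : ι → ℤ} : p ∈ cube s v ↔ v ∈ corners s p := by
  simp only [cube, corners, Fintype.mem_piFinset, mem_Ico, mem_Ioc, sub_lt_iff_lt_add]
  exact forall_congr' fun i => and_comm

theorem card_cube (s : ℕ) (v : ι → ℤ) : #(cube s v) = s ^ Fintype.card ι := by
  simp [cube]

theorem card_corners (s : ℕ) (p : ι → ℤ) : #(corners s p) = s ^ Fintype.card ι := by
  simp [corners]

theorem cube_one (v : ι → ℤ) : cube 1 v = {v} := by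
  ext p
  simp only [cube, Fintype.mem_piFinset, mem_Ico, mem_singleton, funext_iff]
  exact forall_congr' fun i => by omega

theorem card_corners_sdiff_corners_le (s : ℕ) (p q : ι → ℤ) :
    #(corners s q \ corners s p) ≤ s ^ (Fintype.card ι - 1) * ∑ i, (q i - p i).natAbs := by
  rw [mul_sum]
  refine (card_piFinset_sdiff_piFinset_le _ _).trans (sum_le_sum fun i _ => ?_)
  have hprod : ∏ j ∈ univ \ {i}, #(Ioc (q j - s) (q j)) = s ^ (Fintype.card ι - 1) := by
    simp [card_sdiff_of_subset]
  rw [hprod, mul_comm]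
  exact Nat.mul_le_mul_left _ (card_Ioc_sdiff_Ioc_le _ _ _)

end Cubes

theorem natAbs_sub_le_dist_pos (p q : Node) (i : Fin 3) :
    ((q i - p i).natAbs : ℝ) ≤ dist p.pos q.pos := by
  rw [Nat.cast_natAbs, dist_comm, dist_eq_norm]
  simpa [Node.pos] using PiLp.norm_apply_le (q.pos - p.pos) i

/-- An edge enters a set of nodes if it leads into the set from outside. -/
def Transmission.Enters (e : Transmission) (S : Set Node) : Prop :=
  e.src ∉ S ∧ e.dst ∈ S

open Classical in
theorem Transmission.card_filter_enters_cube_le (e : Transmission) (s : ℕ) (V : Finset Node) :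
    (#{v ∈ V | e.Enters (cube s v)} : ℝ) ≤ 3 * s ^ 2 * e.cost := by
  have hsub : {v ∈ V | e.Enters (cube s v)} ⊆ corners s e.dst \ corners s e.src := by
    intro v hv
    obtain ⟨hsrc, hdst⟩ := (mem_filter.1 hv).2
    rw [mem_coe, mem_cube_iff_mem_corners] at hsrc hdst
    exact mem_sdiff.2 ⟨hdst, hsrc⟩
  calc (#{v ∈ V | e.Enters (cube s v)} : ℝ)
      ≤ s ^ 2 * ∑ i, ((e.dst i - e.src i).natAbs : ℝ) := by
        exact_mod_cast (card_le_card hsub).trans (card_corners_sdiff_corners_le s e.src e.dst)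
    _ ≤ s ^ 2 * ∑ _i : Fin 3, e.cost := by
        gcongr with i
        exact natAbs_sub_le_dist_pos e.src e.dst i
    _ = 3 * s ^ 2 * e.cost := by
        rw [sum_const, card_univ, Fintype.card_fin, nsmul_eq_mul]
        push_cast
        ring

namespace Circuit

variable {n k : ℕ}

open Classical in
/-- The in-degree of `S` in the communication multigraph, that is, the number of bits that `S`
receives from outside. -/
noncomputable def inDegree (c : Circuit n k) (S : Set Node) : ℕ :=
  c.edges.countP fun e => e.Enters S

open Classical in
/-- The inputs injected into the nodes of `S`. -/
noncomputable def inputsIn (c : Circuit n k) (S : Set Node) : Finset (Fin n) :=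
  {i | c.inputNode i ∈ S}

open Classical in
/-- The outputs produced at the nodes of `S`. -/
noncomputable def outputsIn (c : Circuit n k) (S : Set Node) : Finset (Fin k) :=
  {j | c.outputNode j ∈ S}

@[simp]
theorem mem_inputsIn {c : Circuit n k} {S : Set Node} {i : Fin n} :
    i ∈ c.inputsIn S ↔ c.inputNode i ∈ S := by
  simp [inputsIn]

@[simp]
theorem mem_outputsIn {c : Circuit n k} {S : Set Node} {j : Fin k} :
    j ∈ c.outputsIn S ↔ c.outputNode j ∈ S := by
  simp [outputsIn]

theorem card_inputsIn_coe_le (c : Circuit n k) (V : Finset Node) : #(c.inputsIn V) ≤ #V :=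
  card_le_card_of_injOn c.inputNode (fun _ hi => mem_inputsIn.1 hi)
    c.inputNode_injective.injOn

theorem bitMeters_nonneg (c : Circuit n k) : 0 ≤ c.bitMeters := by
  refine List.sum_nonneg fun x hx => ?_
  obtain ⟨e, -, rfl⟩ := List.mem_map.1 hx
  exact dist_nonneg

open Classical in
/-- The bits that enter `S` during the transmissions of a list, in chronological order, when the
lists of bits received before are `r`. -/
noncomputable def transcript (c : Circuit n k) (S : Set Node) (y : Fin n → Symbol) :
    List Transmission → (Node → List Bool) → List Bool
  | [], _ => []
  | e :: l, r =>
    (if e.Enters S then [e.msg (c.inputAt y e.src) (r e.src)] else []) ++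
      c.transcript S y l (c.step y r e)

open Classical in
theorem length_transcript (c : Circuit n k) (S : Set Node) (y : Fin n → Symbol)
    (l : List Transmission) (r : Node → List Bool) :
    (c.transcript S y l r).length = l.countP fun e => e.Enters S := by
  induction l generalizing r with
  | nil => rfl
  | cons e l ih =>
    rw [transcript, List.length_append, ih, List.countP_cons]
    by_cases h : e.Enters S <;> simp [h, add_comm]

theorem eqOn_step (c : Circuit n k) {S : Set Node} {y y' : Fin n → Symbol}
    {r r' : Node → List Bool} {e : Transmission}
    (hy : Set.EqOn (c.inputAt y) (c.inputAt y') S) (hr : Set.EqOn r r' S)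
    (he : e.Enters S →
      e.msg (c.inputAt y e.src) (r e.src) = e.msg (c.inputAt y' e.src) (r' e.src)) :
    Set.EqOn (c.step y r e) (c.step y' r' e) S := by
  intro p hp
  unfold step
  rcases eq_or_ne p e.dst with rfl | hpe
  · rw [Function.update_self, Function.update_self, hr hp]
    by_cases hsrc : e.src ∈ S
    · rw [hy hsrc, hr hsrc]
    · rw [he ⟨hsrc, hp⟩]
  · rw [Function.update_of_ne hpe, Function.update_of_ne hpe, hr hp]

theorem eqOn_foldl_step (c : Circuit n k) {S : Set Node} {y y' : Fin n → Symbol}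
    (hy : Set.EqOn (c.inputAt y) (c.inputAt y') S) (l : List Transmission)
    {r r' : Node → List Bool} (hr : Set.EqOn r r' S)
    (ht : c.transcript S y l r = c.transcript S y' l r') :
    Set.EqOn (l.foldl (c.step y) r) (l.foldl (c.step y') r') S := by
  induction l generalizing r r' with
  | nil => exact hr
  | cons e l ih =>
    rw [transcript, transcript] at ht
    obtain ⟨hbit, htail⟩ := List.append_inj ht (by split_ifs <;> rfl)
    refine ih (c.eqOn_step hy hr fun he => ?_) htail
    simpa only [if_pos he, List.cons.injEq, and_true] using hbit

theorem eqOn_inputAt (c : Circuit n k) {S : Set Node} {y y' : Fin n → Symbol}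
    (hy : ∀ i ∈ c.inputsIn S, y i = y' i) : Set.EqOn (c.inputAt y) (c.inputAt y') S := by
  intro p hp
  by_cases hinput : ∃ i, c.inputNode i = p
  · obtain ⟨i, rfl⟩ := hinput
    simp only [inputAt, c.inputNode_injective.extend_apply, hy i (mem_inputsIn.2 hp)]
  · simp only [inputAt, Function.extend_apply' _ _ _ hinput]

theorem eval_eq_of_transcript_eq (c : Circuit n k) {S : Set Node} {y y' : Fin n → Symbol}
    (hy : ∀ i ∈ c.inputsIn S, y i = y' i)
    (ht : c.transcript S y c.edges (fun _ => []) = c.transcript S y' c.edges (fun _ => []))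
    {j : Fin k} (hj : j ∈ c.outputsIn S) : c.eval y j = c.eval y' j := by
  have hinput := c.eqOn_inputAt hy
  have hreceived : Set.EqOn (c.received y) (c.received y') S :=
    c.eqOn_foldl_step hinput c.edges (Set.eqOn_refl _ _) ht
  rw [mem_outputsIn] at hj
  rw [eval, eval, hinput hj, hreceived hj]

open Classical in
theorem sum_inDegree_eq_sum_map_card {κ : Type*} (c : Circuit n k) (V : Finset κ)
    (S : κ → Set Node) :
    ∑ v ∈ V, c.inDegree (S v) = (c.edges.map fun e => #{v ∈ V | e.Enters (S v)}).sum := by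
  unfold inDegree
  induction c.edges with
  | nil => simp
  | cons e l ih =>
    simp only [List.countP_cons, decide_eq_true_eq, sum_add_distrib, ih, List.map_cons,
      List.sum_cons, card_filter, add_comm]

theorem sum_inDegree_cube_le (c : Circuit n k) (s : ℕ) (V : Finset Node) :
    ((∑ v ∈ V, c.inDegree (cube s v) : ℕ) : ℝ) ≤ 3 * s ^ 2 * c.bitMeters := by
  classical
  rw [sum_inDegree_eq_sum_map_card, Nat.cast_list_sum, List.map_map, bitMeters,
    ← List.sum_map_mul_left]
  exact List.sum_le_sum fun e _ => e.card_filter_enters_cube_le s V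

/-- The least corners of the cubes of side `s` that contain an output node. -/
noncomputable def outputCorners (c : Circuit n k) (s : ℕ) : Finset Node :=
  univ.biUnion fun j => corners s (c.outputNode j)

theorem sum_card_outputsIn_cube (c : Circuit n k) (s : ℕ) :
    ∑ v ∈ c.outputCorners s, #(c.outputsIn (cube s v)) = k * s ^ 3 := by
  classical
  calc ∑ v ∈ c.outputCorners s, #(c.outputsIn (cube s v))
      = ∑ j, #{v ∈ c.outputCorners s | c.outputNode j ∈ cube s v} := by
        simp only [outputsIn, mem_coe, card_filter]
        exact sum_comm
    _ = ∑ j, #(corners s (c.outputNode j)) := by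
        refine sum_congr rfl fun j _ => congrArg card ?_
        simp only [mem_cube_iff_mem_corners, filter_mem_eq_inter]
        exact inter_eq_right.2
          (subset_biUnion_of_mem (fun j => corners s (c.outputNode j)) (mem_univ j))
    _ = k * s ^ 3 := by simp [card_corners]

theorem side_mul_le_three_mul_bitMeters (c : Circuit n k) (s : ℕ)
    (h : ∀ v : Node, #(c.outputsIn (cube s v)) ≤ c.inDegree (cube s v)) :
    (s * k : ℝ) ≤ 3 * c.bitMeters := by
  rcases s.eq_zero_or_pos with rfl | hs
  · have := c.bitMeters_nonneg
    simpa
  have hcount : (k * s ^ 3 : ℝ) ≤ 3 * s ^ 2 * c.bitMeters := by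
    refine le_trans ?_ (c.sum_inDegree_cube_le s (c.outputCorners s))
    exact_mod_cast (c.sum_card_outputsIn_cube s).symm.trans_le (sum_le_sum fun v _ => h v)
  refine le_of_mul_le_mul_left ?_ (by positivity : (0 : ℝ) < s ^ 2)
  linarith

open Classical in
/-- The inputs whose nodes output more bits than they receive from other nodes. -/
noncomputable def starvedInputs (c : Circuit n k) : Finset (Fin n) :=
  {i | c.inDegree {c.inputNode i} < #(c.outputsIn {c.inputNode i})}

theorem mem_starvedInputs {c : Circuit n k} {i : Fin n} :
    i ∈ c.starvedInputs ↔ c.inDegree {c.inputNode i} < #(c.outputsIn {c.inputNode i}) := by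
  simp [starvedInputs]

theorem le_three_mul_bitMeters_add_card_starvedInputs (c : Circuit n k)
    (h : ∀ v, #(c.outputsIn {v}) ≤ c.inDegree {v} + #(c.inputsIn {v})) :
    (k : ℝ) ≤ 3 * c.bitMeters + #c.starvedInputs := by
  have hnode (v : Node) :
      #(c.outputsIn {v}) ≤ c.inDegree {v} + #{i ∈ c.starvedInputs | c.inputNode i = v} := by
    by_contra! hlt
    have hall : c.inputsIn {v} ⊆ {i ∈ c.starvedInputs | c.inputNode i = v} := by
      intro i hi
      obtain rfl : c.inputNode i = v := mem_inputsIn.1 hi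
      exact mem_filter.2 ⟨mem_starvedInputs.2 (le_self_add.trans_lt hlt), rfl⟩
    exact hlt.not_ge ((h v).trans (Nat.add_le_add_left (card_le_card hall) _))
  have hout := c.sum_card_outputsIn_cube 1
  have hin := c.sum_inDegree_cube_le 1 (c.outputCorners 1)
  simp only [cube_one, coe_singleton, one_pow, mul_one, Nat.cast_one] at hout hin
  have hsum : k ≤ ∑ v ∈ c.outputCorners 1, c.inDegree {v} + #c.starvedInputs := by
    refine hout.ge.trans ((sum_le_sum fun v _ => hnode v).trans ?_)
    rw [sum_add_distrib, sum_card_fiberwise_eq_card_filter]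
    gcongr
    exact filter_subset _ _
  calc (k : ℝ) ≤ (∑ v ∈ c.outputCorners 1, c.inDegree {v} : ℕ) + #c.starvedInputs := by
        exact_mod_cast hsum
    _ ≤ 3 * c.bitMeters + #c.starvedInputs := by gcongr

end Circuit

section ErasureProb

variable {n : ℕ} {ε : ℝ}

theorem erasureProb_nonneg (hε₀ : 0 ≤ ε) (hε₁ : ε ≤ 1) (E : Finset (Fin n)) :
    0 ≤ erasureProb ε E :=
  mul_nonneg (pow_nonneg hε₀ _) (pow_nonneg (sub_nonneg.2 hε₁) _)

theorem sum_Icc_erasureProb (ε : ℝ) {I J : Finset (Fin n)} (hIJ : I ⊆ J) :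
    ∑ E ∈ Icc I J, erasureProb ε E = ε ^ #I * (1 - ε) ^ #Jᶜ := by
  have hdisj {F : Finset (Fin n)} (hF : F ∈ (J \ I).powerset) : Disjoint I F :=
    disjoint_of_subset_right (mem_powerset.1 hF) disjoint_sdiff
  have hprob (F : Finset (Fin n)) (hF : F ∈ (J \ I).powerset) : erasureProb ε (I ∪ F) =
      ε ^ #I * (1 - ε) ^ #Jᶜ * (ε ^ #F * (1 - ε) ^ (#(J \ I) - #F)) := by
    have hcompl : #(I ∪ F)ᶜ = #Jᶜ + (#(J \ I) - #F) := by
      have hI := card_le_card hIJ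
      have hFJ := card_le_card (mem_powerset.1 hF)
      have hJ := card_le_univ J
      rw [card_sdiff_of_subset hIJ] at hFJ ⊢
      rw [card_compl, card_compl, card_union_of_disjoint (hdisj hF)]
      omega
    rw [erasureProb, hcompl, card_union_of_disjoint (hdisj hF)]
    ring
  have hinj : Set.InjOn (I ∪ ·) ((J \ I).powerset : Set (Finset (Fin n))) := by
    intro F hF G hG hFG
    rw [← union_sdiff_cancel_left (hdisj hF), ← union_sdiff_cancel_left (hdisj hG)]
    exact congrArg (· \ I) hFG
  rw [Icc_eq_image_powerset hIJ, sum_image hinj, sum_congr rfl hprob, ← mul_sum,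
    sum_pow_mul_eq_add_pow, add_sub_cancel, one_pow, mul_one]

theorem sum_erasureProb (ε : ℝ) : ∑ E : Finset (Fin n), erasureProb ε E = 1 := by
  rw [← Icc_bot_top, sum_Icc_erasureProb ε bot_le]
  simp

end ErasureProb

namespace Decoder

variable {n k : ℕ} {ε : ℝ}

open Classical in
/-- The messages that are decoded wrongly when exactly the positions in `E` are erased. -/
noncomputable def failures (D : Decoder n k) (E : Finset (Fin n)) : Finset (Fin k → Bool) :=
  {m | D.circuit.eval (erase (D.encode m) E) ≠ m}

theorem mem_compl_failures {D : Decoder n k} {E : Finset (Fin n)} {m : Fin k → Bool} :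
    m ∈ (D.failures E)ᶜ ↔ D.circuit.eval (erase (D.encode m) E) = m := by
  simp [failures]

theorem blockError_eq_sum_card_failures (D : Decoder n k) (ε : ℝ) :
    D.blockError ε = ∑ E : Finset (Fin n), erasureProb ε E * (#(D.failures E) / 2 ^ k) := by
  classical
  simp_rw [blockError, mul_sum]
  rw [sum_comm]
  refine sum_congr rfl fun E _ => ?_
  rw [← mul_sum, ← mul_sum, failures, natCast_card_filter]
  simp_rw [ne_eq, ite_not, one_div, inv_pow]
  ring

theorem sum_erasureProb_le_two_mul_blockError (D : Decoder n k) (hε₀ : 0 ≤ ε) (hε₁ : ε ≤ 1)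
    (𝓔 : Finset (Finset (Fin n))) (h : ∀ E ∈ 𝓔, 2 ^ k ≤ 2 * #(D.failures E)) :
    ∑ E ∈ 𝓔, erasureProb ε E ≤ 2 * D.blockError ε := by
  rw [blockError_eq_sum_card_failures, mul_sum]
  calc ∑ E ∈ 𝓔, erasureProb ε E
      ≤ ∑ E ∈ 𝓔, 2 * (erasureProb ε E * (#(D.failures E) / 2 ^ k)) := by
        refine sum_le_sum fun E hE => ?_
        have hhalf : (1 : ℝ) ≤ 2 * #(D.failures E) / 2 ^ k := by
          rw [one_le_div (by positivity)]
          exact_mod_cast h E hE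
        calc erasureProb ε E ≤ erasureProb ε E * (2 * #(D.failures E) / 2 ^ k) :=
              le_mul_of_one_le_right (erasureProb_nonneg hε₀ hε₁ E) hhalf
          _ = 2 * (erasureProb ε E * (#(D.failures E) / 2 ^ k)) := by ring
    _ ≤ ∑ E, 2 * (erasureProb ε E * (#(D.failures E) / 2 ^ k)) :=
        sum_le_univ_sum_of_nonneg fun E => by
          have := erasureProb_nonneg hε₀ hε₁ E
          positivity

/-- A correctly decoded message is determined by the bits that enter `S`, the code symbols in `S`
that are not erased, and the message bits that are not output in `S`. -/
theorem card_compl_failures_le (D : Decoder n k) (E : Finset (Fin n)) (S : Set Node) :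
    #(D.failures E)ᶜ ≤ 2 ^ (D.circuit.inDegree S + #(D.circuit.inputsIn S \ E) +
      #(D.circuit.outputsIn S)ᶜ) := by
  set c := D.circuit
  let T (m : Fin k → Bool) : List.Vector Bool (c.inDegree S) :=
    ⟨c.transcript S (erase (D.encode m) E) c.edges fun _ => [], c.length_transcript S _ _ _⟩
  let f (m : ↥(D.failures E)ᶜ) :
      List.Vector Bool (c.inDegree S) × (↥(c.inputsIn S \ E) → Bool) ×
        (↥(c.outputsIn S)ᶜ → Bool) :=
    (T m, fun i => D.encode m i, fun j => m.1 j)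
  have hf : Function.Injective f := by
    rintro ⟨m, hm⟩ ⟨m', hm'⟩ h
    simp only [f, Prod.mk.injEq] at h
    obtain ⟨htranscript, hinputs, houtputs⟩ := h
    have hsymbols : ∀ i ∈ c.inputsIn S, erase (D.encode m) E i = erase (D.encode m') E i := by
      intro i hi
      unfold erase
      split_ifs with hiE
      · rfl
      · exact congrArg some (congrFun hinputs ⟨i, mem_sdiff.2 ⟨hi, hiE⟩⟩)
    ext j
    by_cases hj : j ∈ c.outputsIn S
    · have heval := c.eval_eq_of_transcript_eq hsymbols (congrArg Subtype.val htranscript) hj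
      rwa [mem_compl_failures.1 hm, mem_compl_failures.1 hm'] at heval
    · exact congrFun houtputs ⟨j, mem_compl.2 hj⟩
  calc #(D.failures E)ᶜ = Fintype.card ↥(D.failures E)ᶜ := (Fintype.card_coe _).symm
    _ ≤ _ := Fintype.card_le_of_injective f hf
    _ = _ := by simp [pow_add, mul_assoc]

theorem two_pow_le_two_mul_card_failures (D : Decoder n k) {E : Finset (Fin n)} {S : Set Node}
    (h : D.circuit.inDegree S + #(D.circuit.inputsIn S \ E) < #(D.circuit.outputsIn S)) :
    2 ^ k ≤ 2 * #(D.failures E) := by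
  have hmessages : #(D.failures E)ᶜ + #(D.failures E) = 2 ^ k := by
    rw [card_compl_add_card]
    simp
  have houtputs : #(D.circuit.outputsIn S)ᶜ + #(D.circuit.outputsIn S) = k := by
    rw [card_compl_add_card, Fintype.card_fin]
  have hcorrect : 2 * #(D.failures E)ᶜ ≤ 2 ^ k :=
    calc 2 * #(D.failures E)ᶜ ≤ 2 * 2 ^ (D.circuit.inDegree S + #(D.circuit.inputsIn S \ E) +
          #(D.circuit.outputsIn S)ᶜ) := Nat.mul_le_mul_left 2 (D.card_compl_failures_le E S)
      _ = 2 ^ (D.circuit.inDegree S + #(D.circuit.inputsIn S \ E) +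
          #(D.circuit.outputsIn S)ᶜ + 1) := (pow_succ' _ _).symm
      _ ≤ 2 ^ k := Nat.pow_le_pow_right two_pos (by omega)
  omega

theorem pow_card_inputsIn_le_two_mul_blockError (D : Decoder n k) (hε₀ : 0 ≤ ε) (hε₁ : ε ≤ 1)
    {S : Set Node} (h : D.circuit.inDegree S < #(D.circuit.outputsIn S)) :
    ε ^ #(D.circuit.inputsIn S) ≤ 2 * D.blockError ε := by
  have hprob : ∑ E ∈ Icc (D.circuit.inputsIn S) univ, erasureProb ε E =
      ε ^ #(D.circuit.inputsIn S) := by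
    rw [sum_Icc_erasureProb ε (subset_univ _), compl_univ, card_empty, pow_zero, mul_one]
  rw [← hprob]
  refine D.sum_erasureProb_le_two_mul_blockError hε₀ hε₁ _ fun E hE => ?_
  refine D.two_pow_le_two_mul_card_failures (S := S) ?_
  rwa [sdiff_eq_empty_iff_subset.2 (mem_Icc.1 hE).1, card_empty, add_zero]

theorem blockError_pos (D : Decoder n k) (hε₀ : 0 < ε) (hε₁ : ε ≤ 1) (hk : 0 < k) :
    0 < D.blockError ε := by
  have hcut : D.circuit.inDegree Set.univ < #(D.circuit.outputsIn Set.univ) := by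
    simpa [Circuit.inDegree, Circuit.outputsIn, Transmission.Enters] using hk
  have hpow := D.pow_card_inputsIn_le_two_mul_blockError hε₀.le hε₁ hcut
  have hpos : 0 < ε ^ #(D.circuit.inputsIn Set.univ) := by positivity
  linarith

theorem card_outputsIn_le (D : Decoder n k) (hε₀ : 0 ≤ ε) (hε₁ : ε ≤ 1)
    (hP : D.blockError ε < 1 / 2) (S : Set Node) :
    #(D.circuit.outputsIn S) ≤ D.circuit.inDegree S + #(D.circuit.inputsIn S) := by
  by_contra! hlt
  have hall := D.sum_erasureProb_le_two_mul_blockError hε₀ hε₁ univ fun E _ =>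
    D.two_pow_le_two_mul_card_failures <|
      (Nat.add_le_add_left (card_le_card sdiff_subset) _).trans_lt hlt
  rw [sum_erasureProb] at hall
  linarith

theorem one_sub_pow_card_starvedInputs_le (D : Decoder n k) (hε₀ : 0 ≤ ε) (hε₁ : ε ≤ 1) :
    1 - (1 - ε) ^ #D.circuit.starvedInputs ≤ 2 * D.blockError ε := by
  set c := D.circuit
  have hprob : ∑ E ∈ (Icc ∅ c.starvedInputsᶜ)ᶜ, erasureProb ε E =
      1 - (1 - ε) ^ #c.starvedInputs := by
    have htotal := sum_compl_add_sum (Icc ∅ c.starvedInputsᶜ) (erasureProb ε)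
    rw [sum_erasureProb, sum_Icc_erasureProb ε (empty_subset _), compl_compl, card_empty,
      pow_zero, one_mul] at htotal
    exact eq_sub_of_add_eq htotal
  rw [← hprob]
  refine D.sum_erasureProb_le_two_mul_blockError hε₀ hε₁ _ fun E hE => ?_
  obtain ⟨i, hiE, hi⟩ : ∃ i ∈ E, i ∈ c.starvedInputs := by
    simpa [not_subset] using hE
  have herased : c.inputsIn {c.inputNode i} ⊆ E := by
    intro i' hi'
    have hnode : c.inputNode i' = c.inputNode i :=
      Set.mem_singleton_iff.1 (Circuit.mem_inputsIn.1 hi')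
    rwa [c.inputNode_injective hnode]
  refine D.two_pow_le_two_mul_card_failures (S := {c.inputNode i}) ?_
  rw [sdiff_eq_empty_iff_subset.2 herased, card_empty, add_zero]
  exact Circuit.mem_starvedInputs.1 hi

theorem side_mul_le_three_mul_bitMeters (D : Decoder n k) (hε₀ : 0 ≤ ε) (hε₁ : ε ≤ 1) {s : ℕ}
    (hP : 2 * D.blockError ε < ε ^ s ^ 3) : (s * k : ℝ) ≤ 3 * D.circuit.bitMeters := by
  refine D.circuit.side_mul_le_three_mul_bitMeters s fun v => ?_
  by_contra! hlt
  have hinputs : #(D.circuit.inputsIn (cube s v)) ≤ s ^ 3 := by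
    simpa [card_cube] using D.circuit.card_inputsIn_coe_le (cube s v)
  exact hP.not_ge <| (pow_le_pow_of_le_one hε₀ hε₁ hinputs).trans
    (D.pow_card_inputsIn_le_two_mul_blockError hε₀ hε₁ hlt)

theorem mul_le_six_mul_bitMeters (D : Decoder n k) (hε₀ : 0 < ε) (hε₁ : ε ≤ 1) {y : ℝ}
    (hy : 1 ≤ y) (hP : 2 * D.blockError ε < ε ^ (y ^ 3)) : y * k ≤ 6 * D.circuit.bitMeters := by
  have hfloor_le : (⌊y⌋₊ : ℝ) ≤ y := Nat.floor_le (zero_le_one.trans hy)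
  have hle_floor : y ≤ 2 * ⌊y⌋₊ := by
    have hone : (1 : ℝ) ≤ ⌊y⌋₊ := by exact_mod_cast Nat.floor_pos.2 hy
    linarith [Nat.lt_floor_add_one y]
  have hP_floor : 2 * D.blockError ε < ε ^ ⌊y⌋₊ ^ 3 :=
    calc 2 * D.blockError ε < ε ^ (y ^ 3) := hP
      _ ≤ ε ^ ((⌊y⌋₊ ^ 3 : ℕ) : ℝ) :=
        Real.rpow_le_rpow_of_exponent_ge hε₀ hε₁ (by push_cast; gcongr)
      _ = ε ^ ⌊y⌋₊ ^ 3 := Real.rpow_natCast _ _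
  calc y * k ≤ 2 * ⌊y⌋₊ * k := by gcongr
    _ ≤ 6 * D.circuit.bitMeters := by
        linarith [D.side_mul_le_three_mul_bitMeters hε₀.le hε₁ hP_floor]

theorem le_three_mul_bitMeters_add (D : Decoder n k) (hε₀ : 0 ≤ ε) (hε₁ : ε ≤ 1)
    (hP : D.blockError ε ≤ 1 / 4) {B : ℕ} (hB : (1 - ε) ^ B < 1 / 2) :
    (k : ℝ) ≤ 3 * D.circuit.bitMeters + B := by
  have hstarved : #D.circuit.starvedInputs ≤ B := by
    by_contra! hlt
    have hpow := pow_le_pow_of_le_one (sub_nonneg.2 hε₁) (by linarith) hlt.le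
    have := D.one_sub_pow_card_starvedInputs_le hε₀ hε₁
    linarith
  calc (k : ℝ) ≤ 3 * D.circuit.bitMeters + #D.circuit.starvedInputs :=
        D.circuit.le_three_mul_bitMeters_add_card_starvedInputs fun v =>
          D.card_outputsIn_le hε₀ hε₁ (by linarith) {v}
    _ ≤ 3 * D.circuit.bitMeters + B := by gcongr

end Decoder

theorem rpow_two_mul_cubeRoot_pow_three {ε x : ℝ} (hε₀ : 0 < ε) (hε₁ : ε < 1) (hx : 0 < x) :
    ε ^ (2 * cubeRoot (Real.log x / (2 * Real.log ε)) ^ 3) = x := by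
  have hlog := (Real.log_neg hε₀ hε₁).ne
  rw [cubeRoot_pow_three, Real.rpow_def_of_pos hε₀]
  field_simp
  exact Real.exp_log hx

end BitMeters

theorem mainTheorem2 (ε : ℝ) (hε0 : 0 < ε) (hε1 : ε < 1) :
    ∃ k₀ : ℕ, ∃ p₀ : ℝ, 0 < p₀ ∧
      ∀ (n k : ℕ) (D : BitMeters.Decoder n k), 0 < k →
        (k₀ ≤ k ∨ D.blockError ε ≤ p₀) →
          27 / 512 * BitMeters.cubeRoot
              (Real.log (4 * D.blockError ε) / (2 * Real.log ε)) * (k : ℝ)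
            < D.circuit.bitMeters := by
  obtain ⟨B, hB⟩ := exists_pow_lt_of_lt_one one_half_pos (sub_lt_self 1 hε0)
  refine ⟨2 * B, ε ^ 2 / 4, by positivity, fun n k D hk h => ?_⟩
  have hk' : (0 : ℝ) < k := by exact_mod_cast hk
  have hP := D.blockError_pos hε0 hε1.le hk
  have hPy := BitMeters.rpow_two_mul_cubeRoot_pow_three hε0 hε1 (mul_pos four_pos hP)
  set y := BitMeters.cubeRoot (Real.log (4 * D.blockError ε) / (2 * Real.log ε))
  rcases lt_or_ge y 0 with hy0 | hy0
  · nlinarith [mul_neg_of_neg_of_pos hy0 hk', D.circuit.bitMeters_nonneg]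
  have hy3 : 0 ≤ y ^ 3 := by positivity
  rcases lt_or_ge y 1 with hy1 | hy1
  · have hP_le : 4 * D.blockError ε ≤ 1 := hPy ▸ Real.rpow_le_one hε0.le hε1.le (by positivity)
    have hP_gt : ε ^ (2 : ℝ) < 4 * D.blockError ε :=
      hPy ▸ Real.rpow_lt_rpow_of_exponent_gt hε0 hε1
        (by linarith [pow_lt_one₀ hy0 hy1 three_ne_zero])
    rw [Real.rpow_two] at hP_gt
    have hkB : (2 * B : ℝ) ≤ k := by exact_mod_cast h.resolve_right (by linarith)
    have hbound := D.le_three_mul_bitMeters_add hε0.le hε1.le (by linarith) hB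
    linarith [mul_lt_mul_of_pos_right hy1 hk']
  · have hP_lt : 2 * D.blockError ε < ε ^ (y ^ 3) := calc
      2 * D.blockError ε < ε ^ (2 * y ^ 3) := by linarith
      _ ≤ ε ^ (y ^ 3) := Real.rpow_le_rpow_of_exponent_ge hε0 hε1.le (by linarith)
    have hbound := D.mul_le_six_mul_bitMeters hε0 hε1.le hy1 hP_lt
    linarith [mul_pos (zero_lt_one.trans_le hy1) hk']
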